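/- Let $n\ge 0$ and let $\mathbb{RP}^n$ be the space of lines through the origin of $\mathbb R^{n+1}$, with its quotient topology; $[v]$ denotes the line spanned by $v\neq 0$. Let $\Omega\subset\mathbb{RP}^n$ be a properly convex domain, that is, the image in $\mathbb{RP}^n$ of a nonempty open convex cone of $\mathbb R^{n+1}$ not containing $0$, such that there is no non-constant projective map $\mathbb R\to\Omega$, $t\mapsto [u+tv]$ ($u,v$ linearly independent). Suppose that $\Omega$ is quasi-homogeneous, i.e. there are a compact set $K\subset\Omega$ and a subgroup $G$ of the group $\mathrm{Aut}(\Omega)=\{g\in \mathrm{PGL}(n+1,\mathbb R): g\Omega=\Omega\}$ such that $GK=\Omega$. Then $\Omega$ is strictly convex, i.e. its boundary $\partial\Omega\subset\mathbb{RP}^n$ contains no nondegenerate projective line segment, if and only if $\partial\Omega$ is continuously differentiable, i.e. around each of its points, in a suitable affine chart with suitable linear coordinates $(x_1,\dots,x_n)$, $\partial\Omega$ is given by an equation $x_n=f(x_1,\dots,x_{n-1})$ with $f$ of class $C^1$. -/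

import Mathlib

open scoped LinearAlgebra.Projectivization MatrixGroups Pointwise Topology

/-- Real projective space `ℝℙⁿ`, the space of lines through the origin in `ℝⁿ⁺¹`. -/
abbrev RealProj (n : ℕ) : Type := ℙ ℝ (Fin (n + 1) → ℝ)

/-- The quotient topology of `ℝℙⁿ`, coming from `ℝⁿ⁺¹ ∖ {0}`. -/
noncomputable instance RealProj.instTopologicalSpace (n : ℕ) : TopologicalSpace (RealProj n) :=
  TopologicalSpace.coinduced
    (fun v : {v : Fin (n + 1) → ℝ // v ≠ 0} => Projectivization.mk' ℝ v) inferInstance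

namespace RealProj

variable {n : ℕ}

/-- The preimage of `S ⊆ ℝℙⁿ` in `ℝⁿ⁺¹ ∖ {0}`: the nonzero vectors `v` with `[v] ∈ S`. -/
def lift (S : Set (RealProj n)) : Set (Fin (n + 1) → ℝ) :=
  {v | ∃ hv : v ≠ 0, Projectivization.mk ℝ v hv ∈ S}

/-- The image `{[v] : v ∈ C, v ≠ 0}` in `ℝℙⁿ` of a set of vectors. -/
def proj (C : Set (Fin (n + 1) → ℝ)) : Set (RealProj n) :=
  {p | ∃ v ∈ C, ∃ hv : v ≠ 0, Projectivization.mk ℝ v hv = p}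

/-- A convex domain of `ℝℙⁿ`: the image of a nonempty open convex cone of `ℝⁿ⁺¹` that does not
contain the origin. -/
def IsConvexDomain (Ω : Set (RealProj n)) : Prop :=
  ∃ C : Set (Fin (n + 1) → ℝ), C.Nonempty ∧ IsOpen C ∧ Convex ℝ C ∧
    (∀ v ∈ C, ∀ t : ℝ, 0 < t → t • v ∈ C) ∧ (0 : Fin (n + 1) → ℝ) ∉ C ∧ Ω = proj C

/-- A properly convex domain: a convex domain `Ω` such that no non-constant projective map
`t ↦ [u + t v]` of the affine line `ℝ` takes all its values in `Ω`. Such a map is non-constant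
exactly when `u` and `v` are linearly independent. -/
def IsProperlyConvex (Ω : Set (RealProj n)) : Prop :=
  IsConvexDomain Ω ∧
    ¬ ∃ u v : Fin (n + 1) → ℝ, LinearIndependent ℝ ![u, v] ∧ ∀ t : ℝ, u + t • v ∈ lift Ω

/-- The domain `Ω` is strictly convex if its boundary contains no (nondegenerate) projective line
segment `{[a u + b v] : a, b ≥ 0, (a, b) ≠ (0, 0)}`. -/
def IsStrictlyConvex (Ω : Set (RealProj n)) : Prop :=
  ¬ ∃ u v : Fin (n + 1) → ℝ, LinearIndependent ℝ ![u, v] ∧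
    ∀ a b : ℝ, 0 ≤ a → 0 ≤ b → 0 < a + b → a • u + b • v ∈ lift (frontier Ω)

/-- `Aut(Ω)`: the group of projective transformations preserving `Ω`. -/
noncomputable abbrev Aut (Ω : Set (RealProj n)) : Subgroup PGL(Fin (n + 1), ℝ) :=
  MulAction.stabilizer PGL(Fin (n + 1), ℝ) Ω

/-- `Ω` is a quasi-homogeneous projective domain: it is open, and `G K = Ω` for some compact
`K ⊆ Ω` and some subgroup `G` of `Aut(Ω)`. -/
def IsQuasiHomogeneous (Ω : Set (RealProj n)) : Prop :=
  IsOpen Ω ∧ ∃ K : Set (RealProj n), K ⊆ Ω ∧ IsCompact K ∧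
    ∃ G : Subgroup PGL(Fin (n + 1), ℝ), G ≤ Aut Ω ∧ ⋃ g ∈ G, g • K = Ω

/-- `S ⊆ ℝℙⁿ` is a `C¹` hypersurface: around each of its points it is the graph of a `C¹` function
in a suitable affine chart with suitable coordinates. Given a decomposition
`ℝⁿ⁺¹ = W ⊕ ℝ v ⊕ ℝ e` with `[v] = p`, the affine chart around `p` is `(w, t) ↦ [v + w + t e]`
(defined on `W × ℝ`, which is an `n`-dimensional space), the point `p` has coordinates `(0, 0)`,
and near `(0, 0)` the set `S` has the equation `t = f w`. -/
def IsC1Hypersurface (S : Set (RealProj n)) : Prop :=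
  ∀ p ∈ S, ∃ (v e : Fin (n + 1) → ℝ) (W : Submodule ℝ (Fin (n + 1) → ℝ)) (f : W → ℝ),
    (∃ hv : v ≠ 0, Projectivization.mk ℝ v hv = p) ∧
    LinearIndependent ℝ ![v, e] ∧ IsCompl W (Submodule.span ℝ {v, e}) ∧
    ContDiffAt ℝ 1 f 0 ∧
    ∀ᶠ x : W × ℝ in 𝓝 (0, 0), v + (x.1 : Fin (n + 1) → ℝ) + x.2 • e ∈ lift S ↔ x.2 = f x.1

end RealProj

/-! Everything takes place in the open cone `C` over `Ω`, ordered by `closure C`, with a point `e`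
of `C` and the compact base `dualBase C e` of the dual cone. Strict convexity means that no
functional of the base vanishes at two independent vectors of `closure C`
(`isStrictlyConvex_proj_iff`). Smoothness means that no two functionals of the base vanish at a
common nonzero vector of `closure C` (`isC1Hypersurface_of_unique`, `IsC1Hypersurface.unique`).
These conditions are dual to each other, and quasi-homogeneity makes them equivalent for one and the
same cone.

Indeed, linear automorphisms bring every point of `C` into one order interval from `e` to `M • e`
(`exists_isCoboundedCone`), and order intervals are compact. Given a defect of one kind, choose
points `x` of `C` approaching the boundary in a suitable way, push vectors and functionals forward
by the automorphism that brings `x` back, normalise the functionals at `e`, and pass to a limit. A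
ratio that tends to zero produces a new vanishing, and uniform lower bounds keep the limit
nondegenerate. This yields a defect of the other kind (`exists_segment_of_two_functionals`,
`exists_two_functionals_of_segment`).

For smoothness, the boundary is locally the graph of `w ↦ -min φ (v + w)` over the base. Where the
minimiser is unique it is continuous, and its negative is the derivative. Conversely, the derivative
of a `C¹` graph determines the supporting functional. -/

/-- An open convex cone without lines in its closure. -/
structure IsProperOpenCone {E : Type*} [NormedAddCommGroup E] [NormedSpace ℝ E] (C : Set E) :
    Prop where
  isOpen : IsOpen C
  add_mem : ∀ x ∈ C, ∀ y ∈ C, x + y ∈ C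
  smul_mem : ∀ x ∈ C, ∀ t : ℝ, 0 < t → t • x ∈ C
  zero_notMem : (0 : E) ∉ C
  eq_zero : ∀ x ∈ closure C, -x ∈ closure C → x = 0

/-- The functionals which are nonnegative on `C` and take the value `1` at `e`. -/
def dualBase {E : Type*} [NormedAddCommGroup E] [NormedSpace ℝ E] (C : Set E) (e : E) :
    Set (E →L[ℝ] ℝ) :=
  {φ | (∀ x ∈ C, 0 ≤ φ x) ∧ φ e = 1}

theorem Convex.add_closure_mem_of_cone {E : Type*} [NormedAddCommGroup E] [NormedSpace ℝ E]
    {C : Set E} (hC : Convex ℝ C) (ho : IsOpen C) (hs : ∀ x ∈ C, ∀ t : ℝ, 0 < t → t • x ∈ C)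
    {x y : E} (hx : x ∈ C) (hy : y ∈ closure C) : x + y ∈ C := by
  have h1 := hC.combo_interior_closure_mem_interior (x := x) (y := y)
    (by rwa [ho.interior_eq]) hy (a := 1 / 2) (b := 1 / 2) (by norm_num) (by norm_num)
    (by norm_num)
  have h2 := hs _ (interior_subset h1) 2 (by norm_num)
  simpa [smul_smul] using h2

/-! ### Proper open cones, their order and their dual base -/

namespace IsProperOpenCone

variable {E : Type*} [NormedAddCommGroup E] [NormedSpace ℝ E] {C : Set E}

theorem neg (h : IsProperOpenCone C) : IsProperOpenCone (-C) where
  isOpen := h.isOpen.neg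
  add_mem x hx y hy := by
    rw [Set.mem_neg] at *
    rw [neg_add]
    exact h.add_mem _ hx _ hy
  smul_mem x hx t ht := by
    rw [Set.mem_neg] at *
    rw [← smul_neg]
    exact h.smul_mem _ hx _ ht
  zero_notMem := by simpa using h.zero_notMem
  eq_zero x hx hx' := by
    rw [← neg_closure, Set.mem_neg] at hx hx'
    rw [neg_neg] at hx'
    exact h.eq_zero x hx' hx

theorem convex (h : IsProperOpenCone C) : Convex ℝ C := by
  intro x hx y hy a b ha hb hab
  rcases ha.eq_or_lt with rfl | ha
  · have : b = 1 := by linarith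
    simpa [this] using hy
  rcases hb.eq_or_lt with rfl | hb
  · have : a = 1 := by linarith
    simpa [this] using hx
  exact h.add_mem _ (h.smul_mem x hx a ha) _ (h.smul_mem y hy b hb)

theorem zero_mem_closure (h : IsProperOpenCone C) {e : E} (he : e ∈ C) : (0 : E) ∈ closure C := by
  have h1 : Filter.Tendsto (fun t : ℝ => t • e) (𝓝[>] 0) (𝓝 0) := by
    have : Continuous fun t : ℝ => t • e := by fun_prop
    simpa using (this.tendsto 0).mono_left nhdsWithin_le_nhds
  exact mem_closure_of_tendsto h1
    (Filter.eventually_of_mem self_mem_nhdsWithin fun t ht => h.smul_mem e he t ht)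

theorem closure_add_mem (h : IsProperOpenCone C) {x y : E} (hx : x ∈ closure C)
    (hy : y ∈ closure C) : x + y ∈ closure C :=
  map_mem_closure₂ continuous_add hx hy h.add_mem

theorem closure_smul_mem (h : IsProperOpenCone C) {x : E} (hx : x ∈ closure C) {t : ℝ}
    (ht : 0 ≤ t) : t • x ∈ closure C := by
  rcases ht.eq_or_lt with rfl | ht
  · obtain ⟨e, he⟩ := closure_nonempty_iff.1 ⟨x, hx⟩
    simpa using h.zero_mem_closure he
  · exact map_mem_closure (continuous_const_smul t) hx fun y hy => h.smul_mem y hy t ht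

theorem add_closure_mem (h : IsProperOpenCone C) {x y : E} (hx : x ∈ C) (hy : y ∈ closure C) :
    x + y ∈ C :=
  h.convex.add_closure_mem_of_cone h.isOpen h.smul_mem hx hy

theorem neg_notMem_closure (h : IsProperOpenCone C) {x : E} (hx : x ∈ C) : -x ∉ closure C := by
  intro h1
  have := h.add_closure_mem hx h1
  exact h.zero_notMem (by simpa using this)

theorem dual_closure_nonneg {φ : E →L[ℝ] ℝ} (hφ : ∀ x ∈ C, 0 ≤ φ x) {x : E}
    (hx : x ∈ closure C) : 0 ≤ φ x := by
  have : closure C ⊆ {y | 0 ≤ φ y} :=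
    closure_minimal hφ (isClosed_le continuous_const φ.continuous)
  exact this hx

theorem exists_sub_smul_mem (h : IsProperOpenCone C) {x : E} (hx : x ∈ C) (y : E) :
    ∃ t : ℝ, 0 < t ∧ x - t • y ∈ C := by
  have hc : Continuous fun t : ℝ => x - t • y := by fun_prop
  have h1 : ∀ᶠ t : ℝ in 𝓝[>] 0, x - t • y ∈ C :=
    (hc.tendsto 0).eventually (h.isOpen.mem_nhds (by simpa using hx)) |>.filter_mono
      nhdsWithin_le_nhds
  obtain ⟨t, ht, ht'⟩ := (h1.and self_mem_nhdsWithin).exists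
  exact ⟨t, ht', ht⟩

theorem dual_pos (h : IsProperOpenCone C) {φ : E →L[ℝ] ℝ} (hφ : ∀ x ∈ C, 0 ≤ φ x)
    (hφ0 : φ ≠ 0) {x : E} (hx : x ∈ C) : 0 < φ x := by
  obtain ⟨y, hy⟩ : ∃ y, 0 < φ y := by
    by_contra! hcon
    refine hφ0 (ContinuousLinearMap.ext fun y => le_antisymm (hcon y) ?_)
    have := hcon (-y)
    simp only [map_neg] at this
    simpa using this
  obtain ⟨t, ht, hm⟩ := h.exists_sub_smul_mem hx y
  have h1 := hφ _ hm
  simp only [map_sub, map_smul, smul_eq_mul] at h1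
  nlinarith [mul_pos ht hy]

theorem ne_zero_of_mem_dualBase {e : E} {φ : E →L[ℝ] ℝ} (hφ : φ ∈ dualBase C e) : φ ≠ 0 := by
  rintro rfl
  simpa using hφ.2

/-- Hahn–Banach separation from a cone: a functional bounded below on a cone is nonnegative there.
It is then positive at the interior point `e` and can be normalised. -/
theorem exists_dual_neg (h : IsProperOpenCone C) {e : E} (he : e ∈ C) {y : E}
    (hy : y ∉ closure C) : ∃ φ ∈ dualBase C e, φ y < 0 := by
  obtain ⟨f, u, hfy, hu⟩ := geometric_hahn_banach_point_closed h.convex.closure isClosed_closure hy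
  have hu0 : u < 0 := by simpa using hu 0 (h.zero_mem_closure he)
  have hf : ∀ x ∈ C, 0 ≤ f x := by
    intro x hx
    by_contra! hlt
    have ht : 0 < u / f x := div_pos_of_neg_of_neg hu0 hlt
    have := hu _ (subset_closure (h.smul_mem x hx _ ht))
    rw [map_smul, smul_eq_mul, div_mul_cancel₀ _ hlt.ne] at this
    exact lt_irrefl _ this
  have hf0 : f ≠ 0 := by
    rintro rfl
    simp at hfy
    linarith
  have hfe := h.dual_pos hf hf0 he
  refine ⟨(f e)⁻¹ • f, ⟨fun x hx => ?_, ?_⟩, ?_⟩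
  · exact mul_nonneg (inv_nonneg.2 hfe.le) (hf x hx)
  · exact inv_mul_cancel₀ hfe.ne'
  · exact mul_neg_of_pos_of_neg (inv_pos.2 hfe) (hfy.trans hu0)

theorem isClosed_dualBase (e : E) : IsClosed (dualBase C e) := by
  have h1 : IsClosed (⋂ x ∈ C, {φ : E →L[ℝ] ℝ | 0 ≤ φ x}) :=
    isClosed_biInter fun x _ => isClosed_le continuous_const (by fun_prop)
  have h2 : IsClosed {φ : E →L[ℝ] ℝ | φ e = 1} :=
    isClosed_eq (by fun_prop) continuous_const
  convert h1.inter h2 using 1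
  ext φ
  simp [dualBase]

theorem dualBase_nonempty (h : IsProperOpenCone C) {e : E} (he : e ∈ C) :
    (dualBase C e).Nonempty := by
  obtain ⟨φ, hφ, -⟩ := h.exists_dual_neg he (h.neg_notMem_closure he)
  exact ⟨φ, hφ⟩

theorem mem_closure_iff (h : IsProperOpenCone C) {e : E} (he : e ∈ C) {x : E} :
    x ∈ closure C ↔ ∀ φ ∈ dualBase C e, 0 ≤ φ x := by
  refine ⟨fun hx φ hφ => dual_closure_nonneg hφ.1 hx, fun hx => ?_⟩
  by_contra hcon
  obtain ⟨φ, hφ, hlt⟩ := h.exists_dual_neg he hcon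
  exact absurd (hx φ hφ) (not_le.2 hlt)

theorem notMem_of_max (h : IsProperOpenCone C) {p y : E} {m : ℝ}
    (hm : ∀ t, y - t • p ∈ closure C → t ≤ m) : y - m • p ∉ C := by
  intro hmem
  obtain ⟨t, ht, ht'⟩ := h.exists_sub_smul_mem hmem p
  have := hm (m + t) (subset_closure (by rw [add_smul, ← sub_sub]; exact ht'))
  linarith

theorem exists_dual_pos (h : IsProperOpenCone C) {e : E} (he : e ∈ C) {p : E}
    (hp : p ∈ closure C) (hp0 : p ≠ 0) : ∃ φ ∈ dualBase C e, 0 < φ p := by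
  by_contra! hcon
  refine hp0 (h.eq_zero p hp ((h.mem_closure_iff he).2 fun φ hφ => ?_))
  have := hcon φ hφ
  simpa using this

theorem exists_sub_smul_bound (h : IsProperOpenCone C) {p : E} (hp : p ∈ closure C)
    (hp0 : p ≠ 0) (y : E) : ∃ N : ℝ, ∀ t : ℝ, y - t • p ∈ closure C → t ≤ N := by
  obtain ⟨e, he⟩ := closure_nonempty_iff.1 ⟨p, hp⟩
  obtain ⟨φ, hφ, hpos⟩ := h.exists_dual_pos he hp hp0
  refine ⟨φ y / φ p, fun t ht => ?_⟩
  have := dual_closure_nonneg hφ.1 ht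
  simp only [map_sub, map_smul, smul_eq_mul] at this
  rw [le_div_iff₀ hpos]
  linarith

theorem exists_max_sub_smul (h : IsProperOpenCone C) {p y : E} (hp : p ∈ closure C)
    (hp0 : p ≠ 0) (hy : y ∈ closure C) :
    ∃ m : ℝ, 0 ≤ m ∧ y - m • p ∈ closure C ∧ ∀ t, y - t • p ∈ closure C → t ≤ m := by
  obtain ⟨N, hN⟩ := h.exists_sub_smul_bound hp hp0 y
  have hbdd : BddAbove {t : ℝ | y - t • p ∈ closure C} := ⟨N, hN⟩
  have h0 : (0 : ℝ) ∈ {t : ℝ | y - t • p ∈ closure C} := by simpa using hy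
  have hcl : IsClosed {t : ℝ | y - t • p ∈ closure C} :=
    isClosed_closure.preimage (by fun_prop)
  exact ⟨sSup {t : ℝ | y - t • p ∈ closure C}, le_csSup hbdd h0, hcl.csSup_mem ⟨0, h0⟩ hbdd,
    fun t ht => le_csSup hbdd ht⟩

variable [FiniteDimensional ℝ E]

/-- A ball of radius `r` about `e` inside `C` bounds every functional of the base by `2 / r`. -/
theorem isCompact_dualBase (h : IsProperOpenCone C) {e : E} (he : e ∈ C) :
    IsCompact (dualBase C e) := by
  have : ProperSpace (E →L[ℝ] ℝ) := FiniteDimensional.proper ℝ _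
  obtain ⟨r, hr, hb⟩ := Metric.isOpen_iff.1 h.isOpen e he
  refine (isCompact_closedBall (0 : E →L[ℝ] ℝ) (2 / r)).of_isClosed_subset
    (isClosed_dualBase e) fun φ hφ => ?_
  rw [mem_closedBall_zero_iff]
  have key : ∀ x : E, φ x ≤ 2 / r * ‖x‖ := by
    intro x
    rcases eq_or_ne x 0 with rfl | hx
    · simp
    have hx' : 0 < ‖x‖ := norm_pos_iff.2 hx
    have h1 : e - (r / (2 * ‖x‖)) • x ∈ C := by
      apply hb
      rw [Metric.mem_ball, dist_eq_norm, sub_sub_cancel_left, norm_neg, norm_smul,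
        Real.norm_of_nonneg (by positivity)]
      field_simp
      linarith
    have h2 := hφ.1 _ h1
    simp only [map_sub, map_smul, smul_eq_mul, hφ.2] at h2
    have h3 : r * φ x ≤ 2 * ‖x‖ := by
      field_simp at h2
      linarith
    rw [div_mul_eq_mul_div, le_div_iff₀ hr]
    linarith
  refine φ.opNorm_le_bound (by positivity) fun x => ?_
  rw [Real.norm_eq_abs, abs_le]
  constructor
  · have := key (-x)
    rw [map_neg, norm_neg] at this
    linarith
  · exact key x

theorem mem_iff (h : IsProperOpenCone C) {e : E} (he : e ∈ C) {x : E} :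
    x ∈ C ↔ ∀ φ ∈ dualBase C e, 0 < φ x := by
  refine ⟨fun hx φ hφ => h.dual_pos hφ.1 (ne_zero_of_mem_dualBase hφ) hx, fun hx => ?_⟩
  obtain ⟨φ, hφ, hmin⟩ := (h.isCompact_dualBase he).exists_isMinOn (h.dualBase_nonempty he)
    (f := fun φ => φ x) (by fun_prop)
  -- The minimum over the base is the largest multiple of `e` below `x`. By compactness it is
  -- attained, hence positive.
  have h1 : x - φ x • e ∈ closure C := by
    rw [h.mem_closure_iff he]
    intro ψ hψ
    have := isMinOn_iff.1 hmin ψ hψ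
    simpa [hψ.2] using this
  have := h.add_closure_mem (h.smul_mem e he _ (hx φ hφ)) h1
  simpa using this

theorem exists_dual_eq_zero (h : IsProperOpenCone C) {e : E} (he : e ∈ C) {x : E}
    (hx : x ∈ closure C) (hx' : x ∉ C) : ∃ φ ∈ dualBase C e, φ x = 0 := by
  rw [h.mem_iff he] at hx'
  push Not at hx'
  obtain ⟨φ, hφ, hle⟩ := hx'
  exact ⟨φ, hφ, le_antisymm hle (dual_closure_nonneg hφ.1 hx)⟩

/-- Rescaling unbounded elements of the interval to norm one would give, in the limit, a unit vector
`x` with `x` and `-x` both in `closure C`. -/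
theorem isCompact_Icc (h : IsProperOpenCone C) (y : E) :
    IsCompact {x | x ∈ closure C ∧ y - x ∈ closure C} := by
  have : ProperSpace E := FiniteDimensional.proper ℝ _
  have hcl : IsClosed {x | x ∈ closure C ∧ y - x ∈ closure C} :=
    isClosed_closure.inter (isClosed_closure.preimage (by fun_prop))
  have hZ : IsCompact {z : E × ℝ | (z ∈ (Metric.sphere (0 : E) 1) ×ˢ (Set.Icc (0 : ℝ) 1)) ∧
      z.1 ∈ closure C ∧ z.2 • y - z.1 ∈ closure C} :=
    ((isCompact_sphere _ _).prod CompactIccSpace.isCompact_Icc).inter_right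
      ((isClosed_closure.preimage continuous_fst).inter
        (isClosed_closure.preimage (by fun_prop)))
  have hS : IsClosed (Prod.snd '' {z : E × ℝ | (z ∈ (Metric.sphere (0 : E) 1) ×ˢ
      (Set.Icc (0 : ℝ) 1)) ∧ z.1 ∈ closure C ∧ z.2 • y - z.1 ∈ closure C}) :=
    (hZ.image continuous_snd).isClosed
  have h0 : (0 : ℝ) ∉ (Prod.snd '' {z : E × ℝ | (z ∈ (Metric.sphere (0 : E) 1) ×ˢ
      (Set.Icc (0 : ℝ) 1)) ∧ z.1 ∈ closure C ∧ z.2 • y - z.1 ∈ closure C}) := by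
    rintro ⟨⟨x, s⟩, ⟨⟨hx, -⟩, hxC, hxC'⟩, rfl⟩
    simp only [zero_smul, zero_sub] at hxC'
    have := h.eq_zero x hxC hxC'
    simp [this] at hx
  obtain ⟨r, hr, hb⟩ := Metric.isOpen_iff.1 hS.isOpen_compl 0 h0
  refine (isCompact_closedBall (0 : E) (max 1 (1 / r))).of_isClosed_subset hcl ?_
  rintro x ⟨hx, hyx⟩
  rw [mem_closedBall_zero_iff]
  by_contra! hlt
  have h1 : 1 < ‖x‖ := (le_max_left _ _).trans_lt hlt
  have h2 : 1 / r < ‖x‖ := (le_max_right _ _).trans_lt hlt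
  have hpos : 0 < ‖x‖ := by linarith
  have hmem : ‖x‖⁻¹ ∈ Metric.ball (0 : ℝ) r := by
    rw [mem_ball_zero_iff, Real.norm_of_nonneg (by positivity)]
    rw [div_lt_iff₀ hr] at h2
    rw [inv_lt_iff_one_lt_mul₀ hpos]
    linarith
  refine hb hmem ⟨(‖x‖⁻¹ • x, ‖x‖⁻¹), ⟨⟨?_, ?_, ?_⟩, ?_, ?_⟩, rfl⟩
  · simp [norm_smul, hpos.ne']
  · positivity
  · exact inv_le_one_of_one_le₀ h1.le
  · exact h.closure_smul_mem hx (by positivity)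
  · rw [← smul_sub]
    exact h.closure_smul_mem hyx (by positivity)

end IsProperOpenCone

/-! ### Cobounded cones: exchanging segments and double supports -/

/-- Every point of the cone `C` can be moved by a linear automorphism of `C` between `e` and
`M • e`, for the order defined by `closure C`. -/
def IsCoboundedCone {E : Type*} [NormedAddCommGroup E] [NormedSpace ℝ E] (C : Set E) (e : E)
    (M : ℝ) : Prop :=
  ∀ x ∈ C, ∃ γ : E ≃L[ℝ] E, (∀ y, γ y ∈ C ↔ y ∈ C) ∧ γ x - e ∈ closure C ∧
    M • e - γ x ∈ closure C

theorem IsCompact.exists_eq_zero_of_forall_exists_le {X : Type*} [TopologicalSpace X] {S : Set X}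
    (hS : IsCompact S) {f : X → ℝ} (hf : ContinuousOn f S) (hf0 : ∀ x ∈ S, 0 ≤ f x)
    (h : ∀ δ : ℝ, 0 < δ → ∃ x ∈ S, f x ≤ δ) : ∃ x ∈ S, f x = 0 := by
  obtain ⟨x0, hx0, -⟩ := h 1 one_pos
  obtain ⟨x, hx, hmin⟩ := hS.exists_isMinOn ⟨x0, hx0⟩ hf
  refine ⟨x, hx, le_antisymm (le_of_forall_pos_le_add fun δ hδ => ?_) (hf0 x hx)⟩
  obtain ⟨y, hy, hle⟩ := h δ hδ
  have := isMinOn_iff.1 hmin y hy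
  linarith

namespace IsProperOpenCone

variable {E : Type*} [NormedAddCommGroup E] [NormedSpace ℝ E] {C : Set E}

theorem map_mem_closure_iff {γ : E ≃L[ℝ] E} (hγ : ∀ y, γ y ∈ C ↔ y ∈ C) (y : E) :
    γ y ∈ closure C ↔ y ∈ closure C := by
  have h1 : γ ⁻¹' C = C := Set.ext hγ
  have h2 := γ.toHomeomorph.preimage_closure C
  change γ ⁻¹' closure C = closure (γ ⁻¹' C) at h2
  rw [h1] at h2
  exact Set.ext_iff.1 h2 y

/-- The renormalised push-forward of a functional by an automorphism of the cone. -/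
theorem exists_pushforward (h : IsProperOpenCone C) {e : E} (he : e ∈ C) {M : ℝ}
    {γ : E ≃L[ℝ] E} (hγ : ∀ y, γ y ∈ C ↔ y ∈ C) {x : E} (hx : γ x - e ∈ closure C)
    (hx' : M • e - γ x ∈ closure C) {φ : E →L[ℝ] ℝ} (hφ : φ ∈ dualBase C e) :
    ∃ φ' ∈ dualBase C e, ∃ c : ℝ, 0 < c ∧ c ≤ φ x ∧ φ x ≤ M * c ∧ ∀ z, φ' (γ z) = φ z / c := by
  have hc : 0 < φ (γ.symm e) :=
    h.dual_pos hφ.1 (ne_zero_of_mem_dualBase hφ) ((hγ _).1 (by simpa using he))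
  refine ⟨(φ (γ.symm e))⁻¹ • (φ.comp (γ.symm : E →L[ℝ] E)), ⟨fun y hy => ?_, ?_⟩,
    φ (γ.symm e), hc, ?_, ?_, fun z => ?_⟩
  · have := hφ.1 (γ.symm y) ((hγ _).1 (by simpa using hy))
    simpa using mul_nonneg (inv_nonneg.2 hc.le) this
  · simp [hc.ne']
  · have h1 : x - γ.symm e ∈ closure C := by
      rw [← map_mem_closure_iff hγ]
      simpa using hx
    have := dual_closure_nonneg hφ.1 h1
    simp only [map_sub] at this
    linarith
  · have h1 : M • γ.symm e - x ∈ closure C := by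
      rw [← map_mem_closure_iff hγ]
      simpa using hx'
    have := dual_closure_nonneg hφ.1 h1
    simp only [map_sub, map_smul, smul_eq_mul] at this
    linarith
  · simp [div_eq_inv_mul]

/-- Two functionals supporting at `p` can be modified so that their ratio has infimum `0`. -/
theorem exists_ratio_small (h : IsProperOpenCone C) {e p : E} (he : e ∈ C)
    {φ ψ : E →L[ℝ] ℝ} (hφ : φ ∈ dualBase C e) (hψ : ψ ∈ dualBase C e) (hne : φ ≠ ψ)
    (hφp : φ p = 0) (hψp : ψ p = 0) :
    ∃ φ' ∈ dualBase C e, φ' p = 0 ∧ ∀ δ : ℝ, 0 < δ → ∃ a ∈ C, ψ a = 1 ∧ φ' a < δ := by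
  have hψpos : ∀ x ∈ C, 0 < ψ x := fun x hx => h.dual_pos hψ.1 (ne_zero_of_mem_dualBase hψ) hx
  set R : Set ℝ := (fun x => φ x / ψ x) '' C with hR
  have hRne : R.Nonempty := ⟨_, e, he, rfl⟩
  have hRb : BddBelow R := by
    refine ⟨0, ?_⟩
    rintro _ ⟨x, hx, rfl⟩
    exact div_nonneg (hφ.1 x hx) (hψpos x hx).le
  -- Subtracting from `φ` the largest multiple of `ψ` that leaves it nonnegative on `C` makes the
  -- infimum of the ratio zero.
  set r := sInf R with hr
  have hnn : ∀ x ∈ C, 0 ≤ (φ - r • ψ) x := by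
    intro x hx
    have := csInf_le hRb ⟨x, hx, rfl⟩
    rw [← hr, le_div_iff₀ (hψpos x hx)] at this
    simpa using this
  have hn0 : φ - r • ψ ≠ 0 := by
    intro h0
    have h1 := congrArg (fun f : E →L[ℝ] ℝ => f e) h0
    simp only [sub_apply, smul_apply, smul_eq_mul,
      hφ.2, hψ.2, zero_apply] at h1
    have : r = 1 := by linarith
    rw [this, one_smul, sub_eq_zero] at h0
    exact hne h0
  have hc := h.dual_pos hnn hn0 he
  set c := (φ - r • ψ) e with hcdef
  refine ⟨c⁻¹ • (φ - r • ψ), ⟨fun x hx => mul_nonneg (inv_nonneg.2 hc.le) (hnn x hx),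
    inv_mul_cancel₀ hc.ne'⟩, by simp [hφp, hψp], fun δ hδ => ?_⟩
  obtain ⟨_, ⟨x, hx, rfl⟩, hlt⟩ := exists_lt_of_csInf_lt hRne
    (show sInf R < r + c * δ by rw [← hr]; linarith [mul_pos hc hδ])
  have hx' := hψpos x hx
  refine ⟨(ψ x)⁻¹ • x, h.smul_mem x hx _ (inv_pos.2 hx'), by simp [hx'.ne'], ?_⟩
  simp only [sub_apply, smul_apply, smul_eq_mul,
    map_smul]
  rw [mul_left_comm, inv_mul_lt_iff₀ hc, mul_sub, mul_left_comm, inv_mul_cancel₀ hx'.ne']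
  simp only [div_eq_inv_mul] at hlt
  linarith

variable [FiniteDimensional ℝ E]

/-- Pushing a maximal multiple of `p` below `x`. -/
theorem exists_pushforward_max (h : IsProperOpenCone C) {e : E} (he : e ∈ C) {M : ℝ}
    {γ : E ≃L[ℝ] E} (hγ : ∀ y, γ y ∈ C ↔ y ∈ C) {x p : E} (hxC : x ∈ C)
    (hx : γ x - e ∈ closure C) (hx' : M • e - γ x ∈ closure C) (hp : p ∈ closure C)
    (hp0 : p ≠ 0) :
    ∃ m : ℝ, 0 ≤ m ∧ x - m • p ∈ closure C ∧ γ (m • p) ∈ closure C ∧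
      M • e - γ (m • p) ∈ closure C ∧ ∃ χ ∈ dualBase C e, 1 ≤ χ (γ (m • p)) := by
  obtain ⟨m, hm0, hm, hmax⟩ := h.exists_max_sub_smul hp hp0 (subset_closure hxC)
  have h1 : γ (x - m • p) ∈ closure C := (map_mem_closure_iff hγ _).2 hm
  refine ⟨m, hm0, hm, (map_mem_closure_iff hγ _).2 (h.closure_smul_mem hp hm0), ?_, ?_⟩
  · have := h.closure_add_mem hx' h1
    rwa [map_sub, sub_add_sub_cancel] at this
  -- Some `χ` vanishes at the boundary vector `γ (x - m • p)`, so `χ (γ (m • p)) = χ (γ x) ≥ χ e =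
  -- 1`. This keeps the limit of `γ (m • p)` away from zero.
  · have h2 : γ (x - m • p) ∉ C := fun hcon => h.notMem_of_max hmax ((hγ _).1 hcon)
    obtain ⟨χ, hχ, hχ0⟩ := h.exists_dual_eq_zero he h1 h2
    refine ⟨χ, hχ, ?_⟩
    have h3 := dual_closure_nonneg hχ.1 hx
    simp only [map_sub] at h3 hχ0
    rw [hχ.2] at h3
    linarith

/-- The compact space of configurations of three functionals and two vectors. -/
theorem isCompact_configurations (h : IsProperOpenCone C) {e : E} (he : e ∈ C) (y : E) :
    IsCompact ((dualBase C e ×ˢ dualBase C e ×ˢ dualBase C e) ×ˢ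
      ({x | x ∈ closure C ∧ y - x ∈ closure C} ×ˢ {x | x ∈ closure C ∧ y - x ∈ closure C})) :=
  have hB := h.isCompact_dualBase he
  (hB.prod (hB.prod hB)).prod ((h.isCompact_Icc y).prod (h.isCompact_Icc y))

/-- If some boundary point of a cobounded cone has two supporting hyperplanes, then the boundary
contains a nondegenerate segment. -/
theorem exists_segment_of_two_functionals (h : IsProperOpenCone C) {e p : E} (he : e ∈ C) {M : ℝ}
    (hM : IsCoboundedCone C e M) (hp : p ∈ closure C) (hp0 : p ≠ 0)
    {φ ψ : E →L[ℝ] ℝ} (hφ : φ ∈ dualBase C e) (hψ : ψ ∈ dualBase C e) (hne : φ ≠ ψ)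
    (hφp : φ p = 0) (hψp : ψ p = 0) :
    ∃ φ ∈ dualBase C e, ∃ a ∈ closure C, ∃ b ∈ closure C, LinearIndependent ℝ ![a, b] ∧
      φ a = 0 ∧ φ b = 0 := by
  obtain ⟨φ, hφ, hφp, hsmall⟩ := h.exists_ratio_small he hφ hψ hne hφp hψp
  -- In configurations `(φ', ψ', χ'; a', p')` with these closed constraints, `φ' a' = 0` suffices:
  -- `ψ'` and `χ'` then certify that `a'` and `p'` are independent.
  have hT := (h.isCompact_configurations he (M • e)).inter_right
    (t := {z | 1 / 2 ≤ z.1.2.1 z.2.1 ∧ z.1.1 z.2.2 = 0 ∧ z.1.2.1 z.2.2 = 0 ∧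
      1 ≤ z.1.2.2 z.2.2})
    (by
      simp only [Set.ofPred_and]
      exact (isClosed_le (by fun_prop) (by fun_prop)).inter
        ((isClosed_eq (by fun_prop) (by fun_prop)).inter
        ((isClosed_eq (by fun_prop) (by fun_prop)).inter
        (isClosed_le (by fun_prop) (by fun_prop)))))
  obtain ⟨⟨⟨φ', ψ', χ'⟩, a', p'⟩, ⟨⟨⟨hφ', hψ', hχ'⟩, ⟨ha', -⟩, ⟨hp', -⟩⟩, hψa, hφp', hψp', hχp⟩,
      hzero⟩ :=
    hT.exists_eq_zero_of_forall_exists_le (f := fun z => z.1.1 z.2.1) (by fun_prop)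
      (fun z hz => dual_closure_nonneg hz.1.1.1.1 hz.1.2.1.1) (by
      intro η hη
      have hM0 : 0 ≤ |M| := abs_nonneg M
      obtain ⟨δ, hδ, hδ1, hδη⟩ : ∃ δ : ℝ, 0 < δ ∧ δ ≤ 1 ∧ |M| * δ ≤ η := by
        refine ⟨min 1 (η / (|M| + 1)), by positivity, min_le_left _ _, ?_⟩
        have h1 := min_le_right 1 (η / (|M| + 1))
        rw [le_div_iff₀ (by positivity)] at h1
        have h2 : 0 ≤ min 1 (η / (|M| + 1)) := by positivity
        nlinarith
      -- At `x = a + δ • e`, the normaliser of `φ` satisfies `|M| * c ≥ δ`, so `φ' (γ a) ≤ |M| * δ`.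
      -- That of `ψ` is at most `1 + δ ≤ 2`, so `ψ' (γ a) ≥ 1 / 2`.
      obtain ⟨a, ha, hψa, hφa⟩ := hsmall (δ ^ 2) (by positivity)
      have hx : a + δ • e ∈ C := h.add_mem _ ha _ (h.smul_mem e he δ hδ)
      obtain ⟨γ, hγ, hγ1, hγ2⟩ := hM _ hx
      obtain ⟨φ', hφ', c, hc, hc1, hc2, hφ''⟩ := h.exists_pushforward he hγ hγ1 hγ2 hφ
      obtain ⟨ψ', hψ', d, hd, hd1, hd2, hψ''⟩ := h.exists_pushforward he hγ hγ1 hγ2 hψ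
      obtain ⟨m, hm, -, hm1, hm2, χ, hχ, hχ1⟩ :=
        h.exists_pushforward_max he hγ hx hγ1 hγ2 hp hp0
      refine ⟨⟨⟨φ', ψ', χ⟩, γ a, γ (m • p)⟩, ⟨⟨⟨hφ', hψ', hχ⟩, ⟨?_, ?_⟩, ⟨hm1, hm2⟩⟩,
        ?_, ?_, ?_, hχ1⟩, ?_⟩
      · exact (map_mem_closure_iff hγ _).2 (subset_closure ha)
      · have h1 : γ (δ • e) ∈ closure C :=
          subset_closure ((hγ _).2 (h.smul_mem e he δ hδ))
        have h2 := h.closure_add_mem hγ2 h1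
        rw [map_add] at h2
        convert h2 using 1
        abel
      · simp only [hψ'', hψa]
        simp only [map_add, map_smul, hψa, hψ.2, smul_eq_mul] at hd1
        exact one_div_le_one_div_of_le hd (by linarith)
      · simp [hφ'', hφp]
      · simp [hψ'', hψp]
      · simp only [hφ'']
        have hφa0 := hφ.1 a ha
        simp only [map_add, map_smul, hφ.2, smul_eq_mul] at hc2
        rw [div_le_iff₀ hc]
        have h1 : δ ≤ |M| * c := by
          have := mul_le_mul_of_nonneg_right (le_abs_self M) hc.le
          linarith
        have h2 : δ * δ ≤ (|M| * c) * δ := mul_le_mul_of_nonneg_right h1 hδ.le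
        have h3 : |M| * δ * c ≤ η * c := mul_le_mul_of_nonneg_right hδη hc.le
        nlinarith)
  refine ⟨φ', hφ', a', ha', p', hp', ?_, hzero, hφp'⟩
  rw [LinearIndependent.pair_iff]
  intro s t hst
  have h1 := congrArg ψ' hst
  have h2 := congrArg χ' hst
  simp only [map_add, map_smul, smul_eq_mul, map_zero] at h1 h2
  simp only at hψa hψp' hχp
  rw [hψp', mul_zero, add_zero] at h1
  have hs : s = 0 := by
    rcases mul_eq_zero.1 h1 with h | h
    · exact h
    · linarith
  rw [hs, zero_mul, zero_add] at h2
  refine ⟨hs, ?_⟩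
  rcases mul_eq_zero.1 h2 with h | h
  · exact h
  · linarith

/-- If the boundary of a cobounded cone contains a nondegenerate segment, then some boundary point
has two supporting hyperplanes. -/
theorem exists_two_functionals_of_segment (h : IsProperOpenCone C) {e a b : E} (he : e ∈ C) {M : ℝ}
    (hM : IsCoboundedCone C e M) (ha : a ∈ closure C) (hb : b ∈ closure C)
    (hab : LinearIndependent ℝ ![a, b]) {φ : E →L[ℝ] ℝ} (hφ : φ ∈ dualBase C e)
    (hφa : φ a = 0) (hφb : φ b = 0) :
    ∃ p ∈ closure C, p ≠ 0 ∧ ∃ φ ∈ dualBase C e, ∃ ψ ∈ dualBase C e, φ ≠ ψ ∧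
      φ p = 0 ∧ ψ p = 0 := by
  have hb0 : b ≠ 0 := by simpa using hab.ne_zero 1
  -- Moving `a` to the end of the segment makes `a - δ • b` leave `closure C` for every `δ > 0`;
  -- separation then gives functionals with `α a < δ * α b`.
  obtain ⟨r, -, hr, hrmax⟩ := h.exists_max_sub_smul hb hb0 ha
  have ha0 : a - r • b ≠ 0 := by
    intro h0
    have := LinearIndependent.pair_iff.1 hab 1 (-r) (by rw [one_smul, neg_smul, ← sub_eq_add_neg, h0])
    exact one_ne_zero this.1
  have hsmall : ∀ δ : ℝ, 0 < δ → ∃ α ∈ dualBase C e, α (a - r • b) < δ * α b := by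
    intro δ hδ
    have h1 : a - (r + δ) • b ∉ closure C := fun hcon => by linarith [hrmax _ hcon]
    obtain ⟨α, hα, hlt⟩ := h.exists_dual_neg he h1
    refine ⟨α, hα, ?_⟩
    simp only [map_sub, map_smul, smul_eq_mul] at hlt ⊢
    linarith
  have hφa' : φ (a - r • b) = 0 := by simp [hφa, hφb]
  clear hrmax
  generalize a - r • b = a at hr ha0 hsmall hφa'
  obtain ⟨N, hN⟩ := h.exists_sub_smul_bound hr ha0 (b + e)
  have hT := (h.isCompact_configurations he (M • e)).inter_right
    (t := {z | 1 / 2 ≤ z.1.2.1 z.2.2 ∧ z.1.1 z.2.1 = 0 ∧ z.1.1 z.2.2 = 0 ∧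
      1 ≤ z.1.2.2 z.2.1})
    (by
      simp only [Set.ofPred_and]
      exact (isClosed_le (by fun_prop) (by fun_prop)).inter
        ((isClosed_eq (by fun_prop) (by fun_prop)).inter
        ((isClosed_eq (by fun_prop) (by fun_prop)).inter
        (isClosed_le (by fun_prop) (by fun_prop)))))
  obtain ⟨⟨⟨φ', α', χ'⟩, a', b'⟩, ⟨⟨⟨hφ', hα', hχ'⟩, ⟨ha', -⟩, ⟨hb', -⟩⟩, hαb, hφa, hφb', hχa⟩,
      hzero⟩ :=
    hT.exists_eq_zero_of_forall_exists_le (f := fun z => z.1.2.1 z.2.1) (by fun_prop)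
      (fun z hz => dual_closure_nonneg hz.1.1.2.1.1 hz.1.2.1.1) (by
      intro η hη
      have hM0 : 0 ≤ |M| := abs_nonneg M
      have hN0 : 0 ≤ |N| := abs_nonneg N
      obtain ⟨δ, hδ, hδη⟩ : ∃ δ : ℝ, 0 < δ ∧ |N| * |M| * δ ≤ η := by
        refine ⟨η / (|N| * |M| + 1), by positivity, ?_⟩
        rw [mul_div_assoc', div_le_iff₀ (by positivity)]
        nlinarith
      obtain ⟨α, hα, hαa⟩ := hsmall δ hδ
      have hαa0 := dual_closure_nonneg hα.1 hr
      have hαb : 0 < α b := pos_of_mul_pos_right (hαa0.trans_lt hαa) hδ.le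
      -- The bound `ε ≤ α b` gives `d ≤ 2 * α b`, hence `α' (γ b) ≥ 1 / 2`. The bound `ε ≤ 1` puts
      -- `x` below `b + e`, so `m ≤ N`.
      obtain ⟨ε, hε, hε1, hεα⟩ : ∃ ε : ℝ, 0 < ε ∧ ε ≤ 1 ∧ ε ≤ α b :=
        ⟨min 1 (α b), by positivity, min_le_left _ _, min_le_right _ _⟩
      have hεC := h.smul_mem e he ε hε
      have hx : b + ε • e ∈ C := by
        rw [add_comm]
        exact h.add_closure_mem hεC hb
      obtain ⟨γ, hγ, hγ1, hγ2⟩ := hM _ hx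
      obtain ⟨φ', hφ', c, hc, hc1, hc2, hφ''⟩ := h.exists_pushforward he hγ hγ1 hγ2 hφ
      obtain ⟨α', hα', d, hd, hd1, hd2, hα''⟩ := h.exists_pushforward he hγ hγ1 hγ2 hα
      obtain ⟨m, hm, hmx, hm1, hm2, χ, hχ, hχ1⟩ :=
        h.exists_pushforward_max he hγ hx hγ1 hγ2 hr ha0
      refine ⟨⟨⟨φ', α', χ⟩, γ (m • a), γ b⟩, ⟨⟨⟨hφ', hα', hχ⟩, ⟨hm1, hm2⟩, ⟨?_, ?_⟩⟩,
        ?_, ?_, ?_, hχ1⟩, ?_⟩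
      · exact (map_mem_closure_iff hγ _).2 hb
      · have h2 := h.closure_add_mem hγ2 (subset_closure ((hγ _).2 hεC))
        rw [map_add] at h2
        convert h2 using 1
        abel
      · simp only [hα'']
        simp only [map_add, map_smul, hα.2, smul_eq_mul] at hd1
        rw [div_le_div_iff₀ two_pos hd]
        linarith
      · simp [hφ'', hφa']
      · simp [hφ'', hφb]
      · have hmN : m ≤ |N| := by
          refine (hN m ?_).trans (le_abs_self N)
          have h1 : (1 - ε) • e ∈ closure C :=
            h.closure_smul_mem (subset_closure he) (by linarith)
          convert h.closure_add_mem hmx h1 using 1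
          module
        simp only [hα'', map_smul, smul_eq_mul]
        simp only [map_add, map_smul, hα.2, smul_eq_mul] at hd2
        rw [mul_div_assoc', div_le_iff₀ hd]
        have h1 : α b ≤ |M| * d := by
          have := mul_le_mul_of_nonneg_right (le_abs_self M) hd.le
          linarith
        calc m * α a ≤ |N| * (δ * α b) := by gcongr
          _ ≤ |N| * (δ * (|M| * d)) := by gcongr
          _ = |N| * |M| * δ * d := by ring
          _ ≤ η * d := by gcongr)
  simp only at hαb hφa hφb' hχa hzero
  refine ⟨a', ha', ?_, φ', hφ', α', hα', ?_, hφa, hzero⟩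
  · rintro rfl
    simp at hχa
    linarith
  · rintro rfl
    linarith

end IsProperOpenCone

/-! ### From the projective domain to its cone -/

namespace RealProj

variable {n : ℕ}

theorem IsProperlyConvex.exists_cone {Ω : Set (RealProj n)} (hΩ : IsProperlyConvex Ω) :
    ∃ C : Set (Fin (n + 1) → ℝ), IsProperOpenCone C ∧ C.Nonempty ∧ Ω = proj C := by
  obtain ⟨⟨C, hne, ho, hc, hs, h0, rfl⟩, hl⟩ := hΩ
  refine ⟨C, ⟨ho, fun x hx y hy => hc.add_closure_mem_of_cone ho hs hx (subset_closure hy),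
    hs, h0, fun x hx hx' => ?_⟩, hne, rfl⟩
  by_contra hx0
  obtain ⟨u, hu⟩ := hne
  -- A line in `closure C` can be translated to pass through any point of `C`, contradicting proper
  -- convexity.
  have hline : ∀ t : ℝ, u + t • x ∈ C := by
    intro t
    rcases lt_trichotomy t 0 with ht | rfl | ht
    · have h1 : (-t) • (-x) ∈ closure C :=
        map_mem_closure (continuous_const_smul (-t)) hx' fun y hy => hs y hy _ (neg_pos.2 ht)
      rw [neg_smul_neg] at h1
      exact hc.add_closure_mem_of_cone ho hs hu h1
    · simpa using hu
    · have h1 : t • x ∈ closure C :=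
        map_mem_closure (continuous_const_smul t) hx fun y hy => hs y hy _ ht
      exact hc.add_closure_mem_of_cone ho hs hu h1
  refine hl ⟨u, x, ?_, fun t => ?_⟩
  · rw [LinearIndependent.pair_iff]
    intro s t hst
    have hs0 : s = 0 := by
      by_contra hs0
      refine h0 ?_
      have h1 : u + (s⁻¹ * t) • x = 0 := by
        have := congrArg (fun z => s⁻¹ • z) hst
        simpa [smul_smul, hs0] using this
      rw [← h1]
      exact hline _
    rw [hs0, zero_smul, zero_add, smul_eq_zero] at hst
    exact ⟨hs0, hst.resolve_right hx0⟩
  · have h1 : u + t • x ≠ 0 := fun h => h0 (h ▸ hline t)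
    exact ⟨h1, _, hline t, h1, rfl⟩

theorem mem_lift_proj_iff {C : Set (Fin (n + 1) → ℝ)} (h : IsProperOpenCone C)
    {v : Fin (n + 1) → ℝ} : v ∈ lift (proj C) ↔ v ∈ C ∨ -v ∈ C := by
  constructor
  · rintro ⟨hv, w, hw, hw0, heq⟩
    obtain ⟨a, rfl⟩ := (Projectivization.mk_eq_mk_iff' ℝ _ _ hw0 hv).1 heq
    have ha : a ≠ 0 := by
      rintro rfl
      simp at hw0
    rcases ha.lt_or_gt with ha | ha
    · right
      have := h.smul_mem _ hw (-a)⁻¹ (inv_pos.2 (neg_pos.2 ha))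
      simpa [smul_smul, inv_neg, ha.ne] using this
    · left
      have := h.smul_mem _ hw a⁻¹ (inv_pos.2 ha)
      simpa [smul_smul, ha.ne'] using this
  · rintro (hv | hv)
    · have h1 : v ≠ 0 := fun h0 => h.zero_notMem (h0 ▸ hv)
      exact ⟨h1, v, hv, h1, rfl⟩
    · have h1 : -v ≠ 0 := fun h0 => h.zero_notMem (h0 ▸ hv)
      refine ⟨neg_ne_zero.1 h1, -v, hv, h1, ?_⟩
      rw [Projectivization.mk_eq_mk_iff']
      exact ⟨-1, by simp⟩

theorem proj_neg (C : Set (Fin (n + 1) → ℝ)) : proj (-C) = proj C := by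
  have key : ∀ D : Set (Fin (n + 1) → ℝ), proj (-D) ⊆ proj D := by
    rintro D _ ⟨v, hv, hv0, rfl⟩
    refine ⟨-v, hv, neg_ne_zero.2 hv0, ?_⟩
    rw [Projectivization.mk_eq_mk_iff']
    exact ⟨-1, by simp⟩
  refine (key C).antisymm ?_
  simpa using key (-C)

theorem continuous_mk' :
    Continuous (fun v : {v : Fin (n + 1) → ℝ // v ≠ 0} => Projectivization.mk' ℝ v) :=
  continuous_coinduced_rng

theorem isOpenMap_mk' :
    IsOpenMap (fun v : {v : Fin (n + 1) → ℝ // v ≠ 0} => Projectivization.mk' ℝ v) := by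
  intro U hU
  refine isOpen_coinduced.2 ?_
  have : (fun v : {v : Fin (n + 1) → ℝ // v ≠ 0} => Projectivization.mk' ℝ v) ⁻¹'
      ((fun v : {v : Fin (n + 1) → ℝ // v ≠ 0} => Projectivization.mk' ℝ v) '' U) =
      ⋃ a : ℝˣ, (fun v : {v : Fin (n + 1) → ℝ // v ≠ 0} =>
        (⟨a • (v : Fin (n + 1) → ℝ), (smul_ne_zero_iff_ne a).2 v.2⟩ :
          {v : Fin (n + 1) → ℝ // v ≠ 0})) ⁻¹' U := by
    ext v
    simp only [Set.mem_preimage, Set.mem_image, Set.mem_iUnion]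
    constructor
    · rintro ⟨w, hw, heq⟩
      obtain ⟨a, ha⟩ := (Projectivization.mk_eq_mk_iff ℝ _ _ w.2 v.2).1 heq
      refine ⟨a, ?_⟩
      convert hw using 1
      exact Subtype.ext ha
    · rintro ⟨a, ha⟩
      exact ⟨_, ha, (Projectivization.mk_eq_mk_iff ℝ _ _ _ v.2).2 ⟨a, rfl⟩⟩
  rw [this]
  refine isOpen_iUnion fun a => hU.preimage ?_
  exact Continuous.subtype_mk (continuous_subtype_val.const_smul a) _

/-- Preimages under continuous open maps commute with the frontier; this applies to the quotient map
and to the inclusion of the nonzero vectors. -/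
theorem mem_lift_frontier_iff_mem_frontier_lift (S : Set (RealProj n)) {v : Fin (n + 1) → ℝ}
    (hv : v ≠ 0) : v ∈ lift (frontier S) ↔ v ∈ frontier (lift S) := by
  have h1 := isOpenMap_mk'.preimage_frontier_eq_frontier_preimage continuous_mk' S
  have ho : IsOpen {v : Fin (n + 1) → ℝ | v ≠ 0} := isOpen_ne
  have h2 := ho.isOpenMap_subtype_val.preimage_frontier_eq_frontier_preimage
    continuous_subtype_val (lift S)
  have h3 : (Subtype.val : {v : Fin (n + 1) → ℝ // v ≠ 0} → _) ⁻¹' lift S =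
      (fun v : {v : Fin (n + 1) → ℝ // v ≠ 0} => Projectivization.mk' ℝ v) ⁻¹' S := by
    ext w
    exact ⟨fun ⟨_, h⟩ => h, fun h => ⟨w.2, h⟩⟩
  have h4 := Set.ext_iff.1 (h1.trans ((congrArg frontier h3).symm.trans h2.symm)) ⟨v, hv⟩
  exact ⟨fun ⟨_, h⟩ => h4.1 h, fun h => ⟨hv, h4.2 h⟩⟩

theorem mem_lift_frontier_proj_iff {C : Set (Fin (n + 1) → ℝ)} (h : IsProperOpenCone C)
    {v : Fin (n + 1) → ℝ} : v ∈ lift (frontier (proj C)) ↔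
      v ≠ 0 ∧ ((v ∈ closure C ∧ v ∉ C) ∨ (-v ∈ closure C ∧ -v ∉ C)) := by
  have h1 : lift (proj C) = C ∪ -C := by
    ext v
    exact mem_lift_proj_iff h
  have key : v ≠ 0 → (v ∈ lift (frontier (proj C)) ↔
      ((v ∈ closure C ∧ v ∉ C) ∨ (-v ∈ closure C ∧ -v ∉ C))) := by
    intro hv
    rw [mem_lift_frontier_iff_mem_frontier_lift _ hv, h1, (h.isOpen.union h.isOpen.neg).frontier_eq,
      closure_union, ← neg_closure]
    simp only [Set.mem_sdiff, Set.mem_union, Set.mem_neg, not_or]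
    have h2 : v ∈ closure C → -v ∉ C := fun h3 h4 => by
      have := h.add_closure_mem h4 h3
      exact h.zero_notMem (by simpa using this)
    have h3 : -v ∈ closure C → v ∉ C := fun h3 h4 => h.neg_notMem_closure h4 h3
    tauto
  exact ⟨fun hv => ⟨hv.1, (key hv.1).1 hv⟩, fun hv => (key hv.1).2 hv.2⟩

theorem neg_mem_lift_frontier_proj {C : Set (Fin (n + 1) → ℝ)} (h : IsProperOpenCone C)
    {v : Fin (n + 1) → ℝ} (hv : v ∈ lift (frontier (proj C))) :
    -v ∈ lift (frontier (proj C)) := by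
  rw [mem_lift_frontier_proj_iff h] at *
  rw [neg_neg, or_comm, neg_ne_zero]
  exact hv

/-- The cone over a quasi-homogeneous properly convex domain is cobounded. -/
theorem IsQuasiHomogeneous.exists_isCoboundedCone {C : Set (Fin (n + 1) → ℝ)}
    (h : IsProperOpenCone C) {e : Fin (n + 1) → ℝ} (he : e ∈ C)
    (hq : IsQuasiHomogeneous (proj C)) : ∃ M : ℝ, IsCoboundedCone C e M := by
  obtain ⟨-, K, hKΩ, hK, G, hG, hGK⟩ := hq
  -- The open order intervals from `e` to `j • e` have increasing open images covering `Ω`. One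
  -- image contains `K`, and its index serves as `M`.
  let U : ℕ → Set (RealProj n) := fun j => proj {y | y - e ∈ C ∧ (j : ℝ) • e - y ∈ C}
  have hUo : ∀ j, IsOpen (U j) := by
    intro j
    have h1 : U j = (fun v : {v : Fin (n + 1) → ℝ // v ≠ 0} => Projectivization.mk' ℝ v) ''
        (Subtype.val ⁻¹' {y | y - e ∈ C ∧ (j : ℝ) • e - y ∈ C}) := by
      ext p
      constructor
      · rintro ⟨v, hv, hv0, rfl⟩
        exact ⟨⟨v, hv0⟩, hv, rfl⟩
      · rintro ⟨⟨v, hv0⟩, hv, rfl⟩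
        exact ⟨v, hv, hv0, rfl⟩
    rw [h1]
    apply isOpenMap_mk'
    apply IsOpen.preimage continuous_subtype_val
    exact (h.isOpen.preimage (by fun_prop)).inter (h.isOpen.preimage (by fun_prop))
  have hmono : Monotone U := by
    rintro i j hij _ ⟨v, ⟨hv, hv'⟩, hv0, rfl⟩
    refine ⟨v, ⟨hv, ?_⟩, hv0, rfl⟩
    have h1 : ((j : ℝ) - i) • e ∈ closure C :=
      h.closure_smul_mem (subset_closure he) (by simpa using hij)
    convert h.add_closure_mem hv' h1 using 1
    module
  have hcov : K ⊆ ⋃ j, U j := by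
    refine hKΩ.trans ?_
    rintro _ ⟨v, hv, hv0, rfl⟩
    obtain ⟨t, ht, htm⟩ := h.exists_sub_smul_mem hv e
    obtain ⟨s, hs, hsm⟩ := h.exists_sub_smul_mem he (t⁻¹ • v)
    obtain ⟨j, hj⟩ := exists_nat_ge s⁻¹
    have ht0 : t⁻¹ • v ≠ 0 := smul_ne_zero (inv_ne_zero ht.ne') hv0
    refine Set.mem_iUnion.2 ⟨j, t⁻¹ • v, ⟨?_, ?_⟩, ht0, ?_⟩
    · have := h.smul_mem _ htm t⁻¹ (inv_pos.2 ht)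
      rwa [smul_sub, smul_smul, inv_mul_cancel₀ ht.ne', one_smul] at this
    · have h1 := h.smul_mem _ hsm s⁻¹ (inv_pos.2 hs)
      rw [smul_sub, smul_smul s⁻¹ s, inv_mul_cancel₀ hs.ne', one_smul] at h1
      have h2 : ((j : ℝ) - s⁻¹) • e ∈ closure C :=
        h.closure_smul_mem (subset_closure he) (by linarith)
      convert h.add_closure_mem h1 h2 using 1
      module
    · rw [Projectivization.mk_eq_mk_iff']
      exact ⟨t⁻¹, rfl⟩
  obtain ⟨j, hj⟩ := hK.elim_directed_cover U hUo hcov hmono.directed_le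
  refine ⟨j, fun x hx => ?_⟩
  have hx0 : x ≠ 0 := fun h0 => h.zero_notMem (h0 ▸ hx)
  have hxΩ : Projectivization.mk ℝ x hx0 ∈ proj C := ⟨x, hx, hx0, rfl⟩
  rw [← hGK] at hxΩ
  simp only [Set.mem_iUnion] at hxΩ
  obtain ⟨g, hgG, hg⟩ := hxΩ
  rw [Set.mem_smul_set_iff_inv_smul_mem] at hg
  have hstab : g⁻¹ • proj C = proj C := (Aut (proj C)).inv_mem (hG hgG)
  generalize g⁻¹ = g at hg hstab
  obtain ⟨A, rfl⟩ := Matrix.ProjGenLinGroup.mk_surjective g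
  obtain ⟨y, ⟨hy1, hy2⟩, hy0, hyeq⟩ := hj hg
  have hyC : y ∈ C := by simpa using h.add_mem _ hy1 _ he
  change _ = Projectivization.mk ℝ (A • x) ((smul_ne_zero_iff_ne A).2 hx0) at hyeq
  obtain ⟨a, rfl⟩ := (Projectivization.mk_eq_mk_iff' ℝ _ _ _ _).1 hyeq
  have ha : a ≠ 0 := by
    rintro rfl
    simp at hy0
  -- Scaling by `a` makes `γ x` the representative that lies in the order interval.
  let γ₀ : (Fin (n + 1) → ℝ) ≃ₗ[ℝ] (Fin (n + 1) → ℝ) :=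
    (DistribMulAction.toLinearEquiv ℝ (Fin (n + 1) → ℝ) A).trans
      (LinearEquiv.smulOfNeZero ℝ (Fin (n + 1) → ℝ) a ha)
  let γ : (Fin (n + 1) → ℝ) ≃L[ℝ] (Fin (n + 1) → ℝ) := γ₀.toContinuousLinearEquiv
  have hγ : ∀ v, γ v = a • (A • v) := fun v => rfl
  have hpm : ∀ v, (γ v ∈ C ∨ -γ v ∈ C) ↔ (v ∈ C ∨ -v ∈ C) := by
    intro v
    rw [← mem_lift_proj_iff h, ← mem_lift_proj_iff h, hγ]
    constructor
    · rintro ⟨hv, hm⟩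
      have hv0 : v ≠ 0 := by
        rintro rfl
        simp at hv
      refine ⟨hv0, ?_⟩
      have h1 : Matrix.ProjGenLinGroup.mk A • Projectivization.mk ℝ v hv0 ∈ proj C := by
        convert hm using 1
        change Projectivization.mk ℝ (A • v) ((smul_ne_zero_iff_ne A).2 hv0) = _
        rw [Projectivization.mk_eq_mk_iff']
        exact ⟨a⁻¹, by rw [smul_smul, inv_mul_cancel₀ ha, one_smul]⟩
      rw [← hstab] at h1
      exact Set.smul_mem_smul_set_iff.1 h1
    · rintro ⟨hv, hm⟩
      have h1 : Matrix.ProjGenLinGroup.mk A • Projectivization.mk ℝ v hv ∈ proj C := by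
        rw [← hstab]
        exact Set.smul_mem_smul_set_iff.2 hm
      refine ⟨smul_ne_zero ha ((smul_ne_zero_iff_ne A).2 hv), ?_⟩
      convert h1 using 1
      change _ = Projectivization.mk ℝ (A • v) ((smul_ne_zero_iff_ne A).2 hv)
      rw [Projectivization.mk_eq_mk_iff']
      exact ⟨a, rfl⟩
  -- The map `γ` preserves `C ∪ -C`; since `C` is connected and `γ x ∈ C`, it cannot exchange the
  -- two halves.
  have hdisj : Disjoint C (-C) := by
    rw [Set.disjoint_left]
    intro v hv hv'
    exact h.neg_notMem_closure hv (subset_closure hv')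
  have hγC : ∀ v ∈ C, γ v ∈ C := by
    have h1 : γ '' C ⊆ C ∪ -C := by
      rintro _ ⟨v, hv, rfl⟩
      exact (hpm v).2 (Or.inl hv)
    have h2 : IsPreconnected (γ '' C) :=
      h.convex.isPreconnected.image _ γ.continuous.continuousOn
    rcases h2.subset_or_subset h.isOpen h.isOpen.neg hdisj h1 with h3 | h3
    · exact fun v hv => h3 ⟨v, hv, rfl⟩
    · exact absurd (h3 ⟨x, hx, rfl⟩) (Set.disjoint_left.1 hdisj hyC)
  refine ⟨γ, fun v => ⟨fun hv => ?_, hγC v⟩, subset_closure hy1, subset_closure hy2⟩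
  rcases (hpm v).1 (Or.inl hv) with h1 | h1
  · exact h1
  · have h2 := hγC _ h1
    rw [map_neg] at h2
    exact absurd h2 (Set.disjoint_left.1 hdisj hv)

/-- Shortening the segment keeps it off `-closure C`. A functional supporting at an interior point
of the short segment is nonnegative at both ends, hence vanishes at both. -/
theorem exists_functional_of_segment {C : Set (Fin (n + 1) → ℝ)} (h : IsProperOpenCone C)
    {e u v : Fin (n + 1) → ℝ} (he : e ∈ C) (huv : LinearIndependent ℝ ![u, v])
    (hseg : ∀ a b : ℝ, 0 ≤ a → 0 ≤ b → 0 < a + b → a • u + b • v ∈ lift (frontier (proj C)))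
    (hu : u ∈ closure C) :
    ∃ φ ∈ dualBase C e, ∃ a ∈ closure C, ∃ b ∈ closure C, LinearIndependent ℝ ![a, b] ∧
      φ a = 0 ∧ φ b = 0 := by
  have hu0 : u ≠ 0 := by simpa using huv.ne_zero 0
  have hnu : -u ∉ closure C := fun h1 => hu0 (h.eq_zero u hu h1)
  obtain ⟨ε, hε, hεm⟩ : ∃ ε : ℝ, 0 < ε ∧ -(u + ε • v) ∉ closure C := by
    have hc : Continuous fun t : ℝ => -(u + t • v) := by fun_prop
    have h1 : ∀ᶠ t : ℝ in 𝓝[>] 0, -(u + t • v) ∉ closure C :=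
      (hc.tendsto 0).eventually (isClosed_closure.isOpen_compl.mem_nhds (by simpa using hnu))
        |>.filter_mono nhdsWithin_le_nhds
    obtain ⟨t, ht, ht'⟩ := (h1.and self_mem_nhdsWithin).exists
    exact ⟨t, ht', ht⟩
  have h1 := hseg 1 ε zero_le_one hε.le (by linarith)
  have h2 := hseg 2 ε zero_le_two hε.le (by linarith)
  rw [one_smul, mem_lift_frontier_proj_iff h] at h1
  rw [mem_lift_frontier_proj_iff h] at h2
  have hb : u + ε • v ∈ closure C := by
    rcases h1.2 with h3 | h3
    · exact h3.1
    · exact absurd h3.1 hεm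
  have hsum : (2 : ℝ) • u + ε • v = u + (u + ε • v) := by module
  rw [hsum] at h2
  have hc : u + (u + ε • v) ∉ C := by
    rcases h2.2 with h3 | h3
    · exact h3.2
    · refine absurd ?_ hεm
      convert h.closure_add_mem h3.1 hu using 1
      abel
  obtain ⟨φ, hφ, hφ0⟩ := h.exists_dual_eq_zero he (h.closure_add_mem hu hb) hc
  have hφu := IsProperOpenCone.dual_closure_nonneg hφ.1 hu
  have hφb := IsProperOpenCone.dual_closure_nonneg hφ.1 hb
  rw [map_add] at hφ0
  refine ⟨φ, hφ, u, hu, _, hb, ?_, by linarith, by linarith⟩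
  rw [LinearIndependent.pair_iff] at huv ⊢
  intro s t hst
  obtain ⟨h5, h6⟩ := huv (s + t) (t * ε) (by rw [← hst]; module)
  have ht : t = 0 := (mul_eq_zero.1 h6).resolve_right hε.ne'
  exact ⟨by linarith, ht⟩

/-- Strict convexity, in terms of the cone and its supporting functionals. -/
theorem isStrictlyConvex_proj_iff {C : Set (Fin (n + 1) → ℝ)} (h : IsProperOpenCone C)
    {e : Fin (n + 1) → ℝ} (he : e ∈ C) : IsStrictlyConvex (proj C) ↔
    ¬ ∃ φ ∈ dualBase C e, ∃ a ∈ closure C, ∃ b ∈ closure C, LinearIndependent ℝ ![a, b] ∧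
      φ a = 0 ∧ φ b = 0 := by
  refine not_congr ⟨?_, ?_⟩
  · rintro ⟨u, v, huv, hseg⟩
    have hu := hseg 1 0 zero_le_one le_rfl (by norm_num)
    rw [one_smul, zero_smul, add_zero, mem_lift_frontier_proj_iff h] at hu
    rcases hu.2 with hu | hu
    · exact exists_functional_of_segment h he huv hseg hu.1
    · refine exists_functional_of_segment (u := -u) (v := -v) h he ?_ ?_ hu.1
      · rw [LinearIndependent.pair_iff] at huv ⊢
        intro s t hst
        refine huv s t ?_
        rw [smul_neg, smul_neg, ← neg_add, neg_eq_zero] at hst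
        exact hst
      · intro a b ha hb hab
        convert neg_mem_lift_frontier_proj h (hseg a b ha hb hab) using 1
        module
  · rintro ⟨φ, hφ, a, ha, b, hb, hab, hφa, hφb⟩
    refine ⟨a, b, hab, fun s t hs ht hst => ?_⟩
    rw [mem_lift_frontier_proj_iff h]
    refine ⟨fun h0 => ?_, Or.inl ⟨h.closure_add_mem (h.closure_smul_mem ha hs)
      (h.closure_smul_mem hb ht), fun hmem => ?_⟩⟩
    · have := LinearIndependent.pair_iff.1 hab s t h0
      linarith [this.1, this.2]
    · have := h.dual_pos hφ.1 (IsProperOpenCone.ne_zero_of_mem_dualBase hφ) hmem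
      simp [hφa, hφb] at this

end RealProj

/-! ### Smooth boundaries and unique supporting functionals -/

namespace IsProperOpenCone

variable {E : Type*} [NormedAddCommGroup E] [NormedSpace ℝ E] {C : Set E}

/-- A choice of minimisers over a compact set of functionals is continuous at each point where the
minimiser is unique. -/
theorem continuousAt_minimiser {B : Set (E →L[ℝ] ℝ)} (hB : IsCompact B) {Φ : E → E →L[ℝ] ℝ}
    (hΦ : ∀ x, Φ x ∈ B) (hmin : ∀ x, ∀ ψ ∈ B, Φ x x ≤ ψ x) {x : E}
    (huniq : ∀ φ ∈ B, (∀ ψ ∈ B, φ x ≤ ψ x) → φ = Φ x) : ContinuousAt Φ x := by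
  refine hB.tendsto_nhds_of_unique_mapClusterPt (Filter.Eventually.of_forall hΦ)
    fun φ hφ hcl => huniq φ hφ fun ψ hψ => ?_
  obtain ⟨U, hU, hlim⟩ := mapClusterPt_iff_ultrafilter.1 hcl
  have h1 : Filter.Tendsto (fun y => Φ y y) U (𝓝 (φ x)) :=
    ((by fun_prop : Continuous fun z : (E →L[ℝ] ℝ) × E => z.1 z.2).tendsto (φ, x)).comp
      (hlim.prodMk_nhds hU)
  have h2 : Filter.Tendsto (fun y => ψ y) U (𝓝 (ψ x)) := (ψ.continuous.tendsto x).mono_left hU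
  exact le_of_tendsto_of_tendsto' h1 h2 fun y => hmin y ψ hψ

/-- The upper envelope of a set of functionals is differentiable where the choice of minimisers is
continuous. -/
theorem hasFDerivAt_envelope {B : Set (E →L[ℝ] ℝ)} {Φ : E → E →L[ℝ] ℝ}
    (hΦ : ∀ x, Φ x ∈ B) (hmin : ∀ x, ∀ ψ ∈ B, Φ x x ≤ ψ x) {x : E} (hc : ContinuousAt Φ x) :
    HasFDerivAt (fun y => -Φ y y) (-Φ x) x := by
  refine HasFDerivAt.of_isLittleO (Asymptotics.isLittleO_iff.2 fun c hc0 => ?_)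
  filter_upwards [Metric.continuousAt_iff'.1 hc c hc0] with y hy
  rw [dist_eq_norm, norm_sub_rev] at hy
  have h1 : -Φ y y - -Φ x x - (-Φ x) (y - x) = Φ x y - Φ y y := by
    simp only [map_sub, neg_apply]
    ring
  -- The last summand is nonpositive by minimality at `x`, and the first is small by continuity of
  -- `Φ`.
  have h2 : Φ x y - Φ y y = (Φ x - Φ y) (y - x) + (Φ x x - Φ y x) := by
    simp only [map_sub, sub_apply]
    ring
  have h3 := hmin x _ (hΦ y)
  have h4 := hmin y _ (hΦ x)
  rw [h1, Real.norm_of_nonneg (by linarith), h2]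
  have h5 : (Φ x - Φ y) (y - x) ≤ c * ‖y - x‖ :=
    (le_abs_self _).trans (((Φ x - Φ y).le_opNorm (y - x)).trans (by gcongr))
  linarith

/-- A minimiser at `x` supports the cone at `x - φ x • e`, a vector common to all minimisers and
nonzero off the line of `e`. -/
theorem minimiser_unique (h : IsProperOpenCone C) {e : E} (he : e ∈ C)
    (huniq : ∀ p ∈ closure C, p ≠ 0 → ∀ φ ∈ dualBase C e, ∀ ψ ∈ dualBase C e,
      φ p = 0 → ψ p = 0 → φ = ψ) {x : E} (hx : ∀ c : ℝ, x ≠ c • e) {φ φ' : E →L[ℝ] ℝ}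
    (hφ : φ ∈ dualBase C e) (hφ' : φ' ∈ dualBase C e) (hmin : ∀ ψ ∈ dualBase C e, φ x ≤ ψ x)
    (hmin' : ∀ ψ ∈ dualBase C e, φ' x ≤ ψ x) : φ = φ' := by
  have heq : φ x = φ' x := le_antisymm (hmin φ' hφ') (hmin' φ hφ)
  refine huniq (x - φ x • e) ?_ (sub_ne_zero.2 (hx _)) φ hφ φ' hφ' ?_ ?_
  · rw [h.mem_closure_iff he]
    intro ψ hψ
    simpa [hψ.2] using hmin ψ hψ
  · simp [hφ.2]
  · simp [hφ'.2, heq]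

theorem add_smul_mem_boundary_iff [FiniteDimensional ℝ E] (h : IsProperOpenCone C) {e : E} (he : e ∈ C) {x : E} {t : ℝ}
    {φ : E →L[ℝ] ℝ} (hφ : φ ∈ dualBase C e) (hmin : ∀ ψ ∈ dualBase C e, φ x ≤ ψ x) :
    (x + t • e ∈ closure C ∧ x + t • e ∉ C) ↔ t = -φ x := by
  have h1 : ∀ ψ ∈ dualBase C e, ψ (x + t • e) = ψ x + t := fun ψ hψ => by simp [hψ.2]
  have h2 : x + t • e ∈ closure C ↔ 0 ≤ φ x + t := by
    rw [h.mem_closure_iff he]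
    refine ⟨fun h3 => by simpa [h1 φ hφ] using h3 φ hφ, fun h3 ψ hψ => ?_⟩
    rw [h1 ψ hψ]
    linarith [hmin ψ hψ]
  have h3 : x + t • e ∈ C ↔ 0 < φ x + t := by
    rw [h.mem_iff he]
    refine ⟨fun h3 => by simpa [h1 φ hφ] using h3 φ hφ, fun h3 ψ hψ => ?_⟩
    rw [h1 ψ hψ]
    linarith [hmin ψ hψ]
  rw [h2, h3, not_lt]
  exact ⟨fun h4 => by linarith [h4.1, h4.2], fun h4 => by constructor <;> linarith⟩

end IsProperOpenCone

namespace RealProj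

variable {n : ℕ}

/-- Unique supporting hyperplanes give a boundary of class `C¹`. -/
theorem isC1Hypersurface_of_unique {C : Set (Fin (n + 1) → ℝ)} (h : IsProperOpenCone C)
    {e : Fin (n + 1) → ℝ} (he : e ∈ C)
    (huniq : ∀ p ∈ closure C, p ≠ 0 → ∀ φ ∈ dualBase C e, ∀ ψ ∈ dualBase C e,
      φ p = 0 → ψ p = 0 → φ = ψ) : IsC1Hypersurface (frontier (proj C)) := by
  intro P hP
  obtain ⟨v, hvC, hvC', hv0, hvP⟩ : ∃ v ∈ closure C, v ∉ C ∧
      ∃ hv : v ≠ 0, Projectivization.mk ℝ v hv = P := by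
    have h1 : P.rep ∈ lift (frontier (proj C)) :=
      ⟨P.rep_nonzero, by rwa [Projectivization.mk_rep]⟩
    rw [mem_lift_frontier_proj_iff h] at h1
    obtain ⟨h0, h1 | h1⟩ := h1
    · exact ⟨_, h1.1, h1.2, h0, Projectivization.mk_rep P⟩
    · refine ⟨_, h1.1, h1.2, neg_ne_zero.2 h0, ?_⟩
      conv_rhs => rw [← Projectivization.mk_rep P]
      rw [Projectivization.mk_eq_mk_iff']
      exact ⟨-1, by simp⟩
  have hve : LinearIndependent ℝ ![v, e] := by
    obtain ⟨φ, hφ, hφv⟩ := h.exists_dual_eq_zero he hvC hvC'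
    rw [LinearIndependent.pair_iff]
    intro s t hst
    have ht : t = 0 := by
      have := congrArg φ hst
      simpa [hφv, hφ.2] using this
    rw [ht, zero_smul, add_zero, smul_eq_zero] at hst
    exact ⟨hst.resolve_right hv0, ht⟩
  obtain ⟨W, hW⟩ := Submodule.exists_isCompl (Submodule.span ℝ {v, e})
  have hne : ∀ w ∈ W, ∀ c : ℝ, v + w ≠ c • e := by
    intro w hw c hc
    have h1 : w = c • e - v := by rw [← hc]; abel
    have h2 : w ∈ Submodule.span ℝ {v, e} := by
      rw [h1]
      exact Submodule.sub_mem _ (Submodule.smul_mem _ _ (Submodule.subset_span (by simp)))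
        (Submodule.subset_span (by simp))
    have h3 : w = 0 := Submodule.disjoint_def.1 hW.disjoint w h2 hw
    rw [h3] at h1
    have := LinearIndependent.pair_iff.1 hve (-1) c (by rw [h1]; module)
    linarith [this.1]
  have hcompact := h.isCompact_dualBase he
  choose Φ hΦ hmin using fun x => hcompact.exists_isMinOn (h.dualBase_nonempty he)
    (f := fun φ : (Fin (n + 1) → ℝ) →L[ℝ] ℝ => φ x) (by fun_prop)
  simp only [isMinOn_iff] at hmin
  have hcont : ∀ w : W, ContinuousAt Φ (v + w) := fun w =>
    IsProperOpenCone.continuousAt_minimiser hcompact hΦ hmin fun φ hφ hφmin =>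
      h.minimiser_unique he huniq (hne w w.2) hφ (hΦ _) hφmin (hmin _)
  have hshift : ∀ w : W, HasFDerivAt (fun w : W => v + (w : Fin (n + 1) → ℝ)) W.subtypeL w :=
    fun w => W.subtypeL.hasFDerivAt.const_add v
  refine ⟨v, e, W, fun w => -Φ (v + w) (v + w), ⟨hv0, hvP⟩, hve, hW.symm, ?_, ?_⟩
  · refine contDiffAt_one_iff.2 ⟨fun w => (-Φ (v + w)).comp W.subtypeL, Set.univ,
      Filter.univ_mem, ?_, fun w _ => ?_⟩
    · refine ContinuousOn.clm_comp (fun w _ => ContinuousAt.continuousWithinAt ?_)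
        continuousOn_const
      exact (ContinuousAt.comp (g := Φ) (f := fun w : W => v + (w : Fin (n + 1) → ℝ)) (hcont w)
        (hshift w).continuousAt).neg
    · exact HasFDerivAt.comp (g := fun y => -Φ y y) w
        (IsProperOpenCone.hasFDerivAt_envelope hΦ hmin (hcont w)) (hshift w)
  · have hc : Continuous fun x : W × ℝ => v + (x.1 : Fin (n + 1) → ℝ) + x.2 • e := by fun_prop
    have hnv : -v ∉ closure C := fun h1 => hv0 (h.eq_zero v hvC h1)
    -- Near `v` the chart avoids `-closure C`, so only the boundary of `C` itself is seen.
    have h1 : ∀ᶠ x : W × ℝ in 𝓝 (0, 0), -(v + (x.1 : Fin (n + 1) → ℝ) + x.2 • e) ∉ closure C :=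
      (hc.neg.tendsto (0, 0)).eventually
        (isClosed_closure.isOpen_compl.mem_nhds (by simpa using hnv))
    filter_upwards [h1] with x hx
    rw [mem_lift_frontier_proj_iff h, ← h.add_smul_mem_boundary_iff he (hΦ _) (hmin _)]
    have h0 : v + (x.1 : Fin (n + 1) → ℝ) + x.2 • e ≠ 0 := by
      intro h0
      rw [h0, neg_zero] at hx
      exact hx (h.zero_mem_closure he)
    tauto

/-- A supporting functional is determined, in a `C¹` chart, by the derivative of the graph. -/
theorem supporting_functional_chart {C : Set (Fin (n + 1) → ℝ)} (h : IsProperOpenCone C)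
    {v e : Fin (n + 1) → ℝ} {W : Submodule ℝ (Fin (n + 1) → ℝ)} {f : W → ℝ} {f' : W →L[ℝ] ℝ}
    (hv : v ∈ closure C) (hv0 : v ≠ 0) (hf0 : f 0 = 0) (hf : HasFDerivAt f f' 0)
    (hgraph : ∀ᶠ x : W × ℝ in 𝓝 (0, 0),
      v + (x.1 : Fin (n + 1) → ℝ) + x.2 • e ∈ lift (frontier (proj C)) ↔ x.2 = f x.1)
    {χ : (Fin (n + 1) → ℝ) →L[ℝ] ℝ} (hχ : ∀ x ∈ C, 0 ≤ χ x) (hχv : χ v = 0) (w : W) :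
    χ w = -(f' w * χ e) := by
  have hlim : Filter.Tendsto (fun w : W => (w, f w)) (𝓝 0) (𝓝 (0, 0)) := by
    have := hf.continuousAt.tendsto
    rw [hf0] at this
    exact Filter.tendsto_id.prodMk_nhds this
  have hc : Continuous fun x : W × ℝ => v + (x.1 : Fin (n + 1) → ℝ) + x.2 • e := by fun_prop
  have hnv : -v ∉ closure C := fun h1 => hv0 (h.eq_zero v hv h1)
  have h1 : ∀ᶠ x : W × ℝ in 𝓝 (0, 0), -(v + (x.1 : Fin (n + 1) → ℝ) + x.2 • e) ∉ closure C :=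
    (hc.neg.tendsto (0, 0)).eventually
      (isClosed_closure.isOpen_compl.mem_nhds (by simpa using hnv))
  -- The function is `χ` along the graph: nonnegative near `0` and zero at `0`, so its derivative
  -- vanishes.
  have hmin : IsLocalMin (fun w : W => χ w + f w * χ e) 0 := by
    filter_upwards [hlim.eventually (hgraph.and h1)] with w hw
    have h2 := (mem_lift_frontier_proj_iff h).1 (hw.1.2 rfl)
    have h3 : v + (w : Fin (n + 1) → ℝ) + f w • e ∈ closure C := by
      rcases h2.2 with h4 | h4
      · exact h4.1
      · exact absurd h4.1 hw.2
    have h5 := IsProperOpenCone.dual_closure_nonneg hχ h3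
    simpa [hf0, hχv] using h5
  have hd : HasFDerivAt (fun w : W => χ w + f w * χ e) (χ.comp W.subtypeL + χ e • f') 0 :=
    (χ.comp W.subtypeL).hasFDerivAt.add (hf.mul_const (χ e))
  have h2 := congrArg (fun g : W →L[ℝ] ℝ => g w) (hmin.hasFDerivAt_eq_zero hd)
  simp only [add_apply, smul_apply, smul_eq_mul, zero_apply, ContinuousLinearMap.comp_apply,
    Submodule.subtypeL_apply] at h2
  linarith

/-- A boundary of class `C¹` has unique supporting hyperplanes. -/
theorem IsC1Hypersurface.unique {C : Set (Fin (n + 1) → ℝ)} (h : IsProperOpenCone C)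
    {e : Fin (n + 1) → ℝ} (hC1 : IsC1Hypersurface (frontier (proj C)))
    {p : Fin (n + 1) → ℝ} (hp : p ∈ closure C) (hp0 : p ≠ 0)
    {φ ψ : (Fin (n + 1) → ℝ) →L[ℝ] ℝ} (hφ : φ ∈ dualBase C e) (hψ : ψ ∈ dualBase C e)
    (hφp : φ p = 0) (hψp : ψ p = 0) : φ = ψ := by
  have hpC : p ∉ C := fun hmem =>
    (h.dual_pos hφ.1 (IsProperOpenCone.ne_zero_of_mem_dualBase hφ) hmem).ne' hφp
  obtain ⟨_, hpS⟩ := (mem_lift_frontier_proj_iff h).2 ⟨hp0, Or.inl ⟨hp, hpC⟩⟩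
  obtain ⟨v, e', W, f, ⟨hv0, hvp⟩, -, hW, hf, hgraph⟩ := hC1 _ hpS
  obtain ⟨a, rfl⟩ := (Projectivization.mk_eq_mk_iff' ℝ _ _ _ _).1 hvp
  have hf0 : f 0 = 0 := by
    have := hgraph.self_of_nhds
    simp only [Submodule.coe_zero, add_zero, zero_smul] at this
    exact (this.1 ⟨hv0, hvp ▸ hpS⟩).symm
  have hfd := (hf.differentiableAt one_ne_zero).hasFDerivAt
  have key : ∀ χ ∈ dualBase C e, χ p = 0 → ∀ w : W, χ w = -(fderiv ℝ f 0 w * χ e') := by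
    intro χ hχ hχp w
    -- The chart may be centred at a negative multiple of `p`; then `-C` and `-χ` replace `C` and
    -- `χ`.
    rcases lt_or_ge a 0 with ha | ha
    · have h1 := supporting_functional_chart h.neg (χ := -χ) (v := a • p) (e := e') ?_ hv0 hf0 hfd
        (by rwa [proj_neg]) ?_ (by simp [hχp]) w
      · simp only [neg_apply] at h1
        linarith
      · rw [← neg_closure, Set.mem_neg, ← neg_smul]
        exact h.closure_smul_mem hp (by linarith)
      · intro x hx
        have := hχ.1 _ hx
        simpa using this
    · exact supporting_functional_chart h (h.closure_smul_mem hp ha) hv0 hf0 hfd hgraph hχ.1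
        (by simp [hχp]) w
  have hext : ∀ ρ : (Fin (n + 1) → ℝ) →L[ℝ] ℝ, (∀ w : W, ρ w = 0) → ρ p = 0 → ρ e' = 0 →
      ρ = 0 := by
    intro ρ hρW hρp hρe
    have hle : W ⊔ Submodule.span ℝ {a • p, e'} ≤ LinearMap.ker (ρ : (Fin (n + 1) → ℝ) →ₗ[ℝ] ℝ) := by
      refine sup_le (fun w hw => hρW ⟨w, hw⟩) (Submodule.span_le.2 ?_)
      rintro x (rfl | rfl)
      · simp [hρp]
      · exact hρe
    rw [hW.sup_eq_top] at hle
    ext1 x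
    exact hle (Submodule.mem_top (x := x))
  -- This combination is chosen to vanish at `e'`. Evaluation at `e`, where both functionals equal
  -- `1`, then gives `ψ e' = φ e'`.
  have hρ : ψ e' • φ - φ e' • ψ = 0 := by
    refine hext _ (fun w => ?_) ?_ ?_
    · simp only [sub_apply, smul_apply, smul_eq_mul, key φ hφ hφp, key ψ hψ hψp]
      ring
    · simp [hφp, hψp]
    · simp only [sub_apply, smul_apply, smul_eq_mul]
      ring
  have heq : ψ e' = φ e' := by
    have := congrArg (fun g : (Fin (n + 1) → ℝ) →L[ℝ] ℝ => g e) hρ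
    simp only [sub_apply, smul_apply, smul_eq_mul, hφ.2, hψ.2, zero_apply] at this
    linarith
  refine sub_eq_zero.1 (hext (φ - ψ) (fun w => ?_) ?_ ?_)
  · simp only [sub_apply, key φ hφ hφp, key ψ hψ hψp, heq]
    ring
  · simp [hφp, hψp]
  · simp [heq]

end RealProj

theorem proposition5p10 (n : ℕ) (Ω : Set (RealProj n))
    (hΩ : RealProj.IsProperlyConvex Ω) (hq : RealProj.IsQuasiHomogeneous Ω) :
    RealProj.IsStrictlyConvex Ω ↔ RealProj.IsC1Hypersurface (frontier Ω) := by
  obtain ⟨C, h, ⟨e, he⟩, rfl⟩ := hΩ.exists_cone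
  obtain ⟨M, hM⟩ := hq.exists_isCoboundedCone h he
  rw [RealProj.isStrictlyConvex_proj_iff h he]
  constructor
  · intro hs
    refine RealProj.isC1Hypersurface_of_unique h he fun p hp hp0 φ hφ ψ hψ hφp hψp => ?_
    by_contra hne
    exact hs (h.exists_segment_of_two_functionals he hM hp hp0 hφ hψ hne hφp hψp)
  · rintro hC1 ⟨φ, hφ, a, ha, b, hb, hab, hφa, hφb⟩
    obtain ⟨p, hp, hp0, φ, hφ, ψ, hψ, hne, hφp, hψp⟩ :=
      h.exists_two_functionals_of_segment he hM ha hb hab hφ hφa hφb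
    exact hne (hC1.unique h hp hp0 hφ hψ hφp hψp)
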